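/- Let $A\in\mathbb{R}^{m\times n}$, $B\in\mathbb{R}^{m\times p}$, $C\in\mathbb{R}^{q\times n}$, let $r\ge 0$ be an integer, and let $\|\cdot\|$ be the Frobenius norm. Consider $$\min_{X\in\mathbb{R}^{p\times q},\ \operatorname{rank}X\le r}\ \|A-BXC\|. \qquad (*)$$ Call $M=U\Sigma V^{\mathsf T}$ a singular value decomposition if $U,V$ are orthogonal and $\Sigma$ is rectangular diagonal with nonnegative nonincreasing diagonal entries $\sigma_1(M)\ge\sigma_2(M)\ge\cdots$ (continued by zeros). Put $s=\operatorname{rank}B$, $t=\operatorname{rank}C$. Then $B$ and $C$ have singular value decompositions. For any such decompositions $B=U_B\Sigma_B' V_B^{\mathsf T}$ and $C=U_C\Sigma_C' V_C^{\mathsf T}$, let $S_B=\operatorname{diag}(\sigma_1(B),\dots,\sigma_s(B))$, $S_C=\operatorname{diag}(\sigma_1(C),\dots,\sigma_t(C))$, and let $A_{11}\in\mathbb{R}^{s\times t}$ be the leading $s\times t$ block of $U_B^{\mathsf T}AV_C$. For a singular value decomposition $A_{11}=U\Sigma V^{\mathsf T}$, let $U_r\Sigma_rV_r^{\mathsf T}$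 be obtained from it by keeping only the first $r$ singular values (all of them if $r\ge\min(s,t)$), and let $$X=V_B\begin{bmatrix}S_B^{-1}U_r\Sigma_rV_r^{\mathsf T}S_C^{-1}&0\\0&0\end{bmatrix}U_C^{\mathsf T}\in\mathbb{R}^{p\times q}.$$ Then $S_B$ and $S_C$ have positive diagonal entries, and: 1. For every singular value decomposition of $A_{11}$, the matrix $U_r\Sigma_rV_r^{\mathsf T}$ is a best approximation of $A_{11}$ of rank at most $r$, and $X$ is a global solution of $(*)$. 2. For every singular value decomposition of $A_{11}$, $X$ is the unique matrix of minimum norm among all $Y\in\mathbb{R}^{p\times q}$ with $BYC=BXC$. 3. If $r=0$, or $\sigma_{r+1}(A_{11})<\sigma_r(A_{11})$, or $\sigma_{r+1}(A_{11})=0$, then $X$ is the unique minimum-norm solution of $(*)$, that is, the unique global solution of least Frobenius norm. 4. In all cases, there is a singular value decomposition of $A_{11}$ for which $X$ is a minimum-norm solution of $(*)$. -/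

import Mathlib

open scoped Matrix Matrix.Norms.Frobenius

namespace RankApprox

/-- The rectangular diagonal `m × n` matrix with diagonal entries `σ 0, σ 1, …`
(entries of `σ` beyond the diagonal are ignored). -/
def rectDiag (m n : ℕ) (σ : ℕ → ℝ) : Matrix (Fin m) (Fin n) ℝ :=
  Matrix.of fun i j => if (i : ℕ) = (j : ℕ) then σ i else 0

/-- `M = U Σ Vᵀ` is a (full) singular value decomposition: `U`, `V` are orthogonal, and `Σ` is
rectangular diagonal with nonincreasing nonnegative diagonal `σ`. Indices start at `0`, so `σ k` is
the `(k + 1)`-st singular value; the list is continued by zeros. -/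
structure IsSVD {m n : ℕ} (M : Matrix (Fin m) (Fin n) ℝ)
    (U : Matrix (Fin m) (Fin m) ℝ) (σ : ℕ → ℝ) (V : Matrix (Fin n) (Fin n) ℝ) : Prop where
  left_orthogonal : U ∈ Matrix.orthogonalGroup (Fin m) ℝ
  right_orthogonal : V ∈ Matrix.orthogonalGroup (Fin n) ℝ
  nonneg : ∀ k, 0 ≤ σ k
  antitone : Antitone σ
  eq_zero : ∀ k, min m n ≤ k → σ k = 0
  factorization : M = U * rectDiag m n σ * Vᵀ

/-- `U_r Σ_r V_rᵀ`: the decomposition `U Σ Vᵀ` with only the first `r` singular values kept. -/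
def truncation {m n : ℕ} (U : Matrix (Fin m) (Fin m) ℝ) (σ : ℕ → ℝ)
    (V : Matrix (Fin n) (Fin n) ℝ) (r : ℕ) : Matrix (Fin m) (Fin n) ℝ :=
  U * rectDiag m n (fun k => if k < r then σ k else 0) * Vᵀ

/-- `T` is a best approximation of `M`, in the Frobenius norm, among matrices of rank at most
`r`. -/
def IsBestRankApprox {m n : ℕ} (M : Matrix (Fin m) (Fin n) ℝ) (r : ℕ)
    (T : Matrix (Fin m) (Fin n) ℝ) : Prop :=
  T.rank ≤ r ∧ ∀ T' : Matrix (Fin m) (Fin n) ℝ, T'.rank ≤ r → ‖M - T‖ ≤ ‖M - T'‖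

/-- `X` is a global solution of `min_{rank X ≤ r} ‖A - B X C‖` (Frobenius norm). -/
def IsSolution {m n p q : ℕ} (A : Matrix (Fin m) (Fin n) ℝ) (B : Matrix (Fin m) (Fin p) ℝ)
    (C : Matrix (Fin q) (Fin n) ℝ) (r : ℕ) (X : Matrix (Fin p) (Fin q) ℝ) : Prop :=
  X.rank ≤ r ∧
    ∀ Y : Matrix (Fin p) (Fin q) ℝ, Y.rank ≤ r → ‖A - B * X * C‖ ≤ ‖A - B * Y * C‖

/-- `X` is a global solution of least Frobenius norm among all global solutions. -/
def IsMinNormSolution {m n p q : ℕ} (A : Matrix (Fin m) (Fin n) ℝ) (B : Matrix (Fin m) (Fin p) ℝ)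
    (C : Matrix (Fin q) (Fin n) ℝ) (r : ℕ) (X : Matrix (Fin p) (Fin q) ℝ) : Prop :=
  IsSolution A B C r X ∧ ∀ Y : Matrix (Fin p) (Fin q) ℝ, IsSolution A B C r Y → ‖X‖ ≤ ‖Y‖

/-- `A₁₁`: the leading `s × t` block of `U_Bᵀ A V_C`, where `s = rank B` and `t = rank C`. -/
noncomputable def block11 {m n p q : ℕ} (A : Matrix (Fin m) (Fin n) ℝ)
    (B : Matrix (Fin m) (Fin p) ℝ) (C : Matrix (Fin q) (Fin n) ℝ)
    (UB : Matrix (Fin m) (Fin m) ℝ) (VC : Matrix (Fin n) (Fin n) ℝ) :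
    Matrix (Fin B.rank) (Fin C.rank) ℝ :=
  (UBᵀ * A * VC).submatrix (Fin.castLE B.rank_le_height) (Fin.castLE C.rank_le_width)

/-- The `p × q` matrix with leading `s × t` block `Y` and zeros elsewhere. -/
def padZero {s t : ℕ} (p q : ℕ) (Y : Matrix (Fin s) (Fin t) ℝ) : Matrix (Fin p) (Fin q) ℝ :=
  Matrix.of fun i j => if h : (i : ℕ) < s ∧ (j : ℕ) < t then Y ⟨i, h.1⟩ ⟨j, h.2⟩ else 0

/-- `V_B diag(S_B⁻¹ T S_C⁻¹, 0) U_Cᵀ`, where `S_B = diag(σ₁(B), …, σ_s(B))` and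
`S_C = diag(σ₁(C), …, σ_t(C))`. -/
noncomputable def liftSolution {p q s t : ℕ} (VB : Matrix (Fin p) (Fin p) ℝ) (σB : ℕ → ℝ)
    (UC : Matrix (Fin q) (Fin q) ℝ) (σC : ℕ → ℝ) (T : Matrix (Fin s) (Fin t) ℝ) :
    Matrix (Fin p) (Fin q) ℝ :=
  VB * padZero p q
    ((Matrix.diagonal fun i : Fin s => σB i)⁻¹ * T * (Matrix.diagonal fun j : Fin t => σC j)⁻¹) * UCᵀ

end RankApprox

/-! Compact factorizations of `B` and `C` show that `B * X * C` depends only on a compression of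
`X`, and that `‖A - B * X * C‖ ^ 2` is, up to a constant, the squared distance from `A₁₁` to a
matrix that runs through all matrices of rank at most `r`. Thus solutions correspond to best
approximations of `A₁₁` (`IsCompactFactorization.isSolution_iff`), and the lift of a best
approximation is the strictly shortest matrix with its compression.

Eckart–Young is proved with projections. A matrix `T` of rank at most `r` is fixed by a projection
`P` of trace at most `r`, and Pythagoras reduces the problem to maximizing `‖P * M‖ ^ 2`. This is a
sum of the `σ i ^ 2` with weights in `[0, 1]` of total at most `r`, largest when the weights sit on
the first `r` indices; a gap after them makes the maximizer unique.

Without a gap, compactness yields a best approximation `T` whose lift is shortest. An SVD of `M +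
T`, with its first `r` singular values halved, is an SVD of `M` that truncates to `T`
(`IsBestRankApprox.exists_isSVD`). -/

namespace RankApprox

open Matrix

/-! ### Pythagorean identities for the Frobenius norm. -/

section Frobenius

variable {ι κ ι' κ' : Type*} [Fintype ι] [Fintype κ] [Fintype ι'] [Fintype κ']

theorem frobenius_sq_eq_sum (M : Matrix ι κ ℝ) : ‖M‖ ^ 2 = ∑ i, ∑ j, M i j ^ 2 := by
  rw [frobenius_norm_def, ← Real.sqrt_eq_rpow, Real.sq_sqrt]
  · simp
  · positivity

theorem frobenius_sq_eq_trace (M : Matrix ι κ ℝ) : ‖M‖ ^ 2 = (Mᵀ * M).trace := by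
  rw [frobenius_sq_eq_sum, Finset.sum_comm]
  simp [trace, mul_apply, pow_two]

theorem frobenius_sq_sub (M N : Matrix ι κ ℝ) :
    ‖M - N‖ ^ 2 = ‖M‖ ^ 2 - 2 * (Mᵀ * N).trace + ‖N‖ ^ 2 := by
  have h : (Nᵀ * M).trace = (Mᵀ * N).trace := by
    rw [← trace_transpose, transpose_mul, transpose_transpose]
  simp only [frobenius_sq_eq_trace, transpose_sub, Matrix.sub_mul, Matrix.mul_sub, trace_sub, h]
  ring

theorem frobenius_sq_isometry [DecidableEq ι'] [DecidableEq κ'] {P : Matrix ι ι' ℝ}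
    {Q : Matrix κ κ' ℝ} (hP : Pᵀ * P = 1) (hQ : Qᵀ * Q = 1) (Y : Matrix ι' κ' ℝ) :
    ‖P * Y * Qᵀ‖ ^ 2 = ‖Y‖ ^ 2 := by
  rw [frobenius_sq_eq_trace, frobenius_sq_eq_trace]
  have : (P * Y * Qᵀ)ᵀ * (P * Y * Qᵀ) = Q * (Yᵀ * ((Pᵀ * P) * Y) * Qᵀ) := by
    simp only [transpose_mul, transpose_transpose, Matrix.mul_assoc]
  rw [this, trace_mul_comm, hP, Matrix.one_mul, Matrix.mul_assoc, hQ, Matrix.mul_one]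

/-- The cross terms agree by cyclicity of the trace. The last bracket is free of `Y`, so minimizing
over `Y` only involves the compression of `A`. -/
theorem frobenius_sq_sub_isometry [DecidableEq ι'] [DecidableEq κ'] {P : Matrix ι ι' ℝ}
    {Q : Matrix κ κ' ℝ} (hP : Pᵀ * P = 1) (hQ : Qᵀ * Q = 1) (A : Matrix ι κ ℝ)
    (Y : Matrix ι' κ' ℝ) :
    ‖A - P * Y * Qᵀ‖ ^ 2 = ‖Pᵀ * A * Q - Y‖ ^ 2 + (‖A‖ ^ 2 - ‖Pᵀ * A * Q‖ ^ 2) := by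
  rw [frobenius_sq_sub, frobenius_sq_sub, frobenius_sq_isometry hP hQ]
  have : (Aᵀ * (P * Y * Qᵀ)).trace = ((Pᵀ * A * Q)ᵀ * Y).trace := by
    rw [← Matrix.mul_assoc, trace_mul_comm]
    simp only [transpose_mul, transpose_transpose, Matrix.mul_assoc]
  rw [this]
  ring

theorem frobenius_sq_sub_projection {P : Matrix ι ι ℝ} (hs : Pᵀ = P)
    (M : Matrix ι κ ℝ) {T : Matrix ι κ ℝ} (hT : P * T = T) :
    ‖M - T‖ ^ 2 = ‖P * M - T‖ ^ 2 + (‖M‖ ^ 2 - ‖P * M‖ ^ 2) := by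
  rw [frobenius_sq_sub, frobenius_sq_sub]
  have : ((P * M)ᵀ * T).trace = (Mᵀ * T).trace := by
    rw [transpose_mul, hs, Matrix.mul_assoc, hT]
  rw [this]
  ring

theorem frobenius_sq_projection_add {P : Matrix ι ι ℝ} (hs : Pᵀ = P) (hi : P * P = P)
    (M : Matrix ι κ ℝ) : ‖M‖ ^ 2 = ‖P * M - M‖ ^ 2 + ‖P * M‖ ^ 2 := by
  have h := frobenius_sq_sub_projection hs M (T := P * M) (by rw [← Matrix.mul_assoc, hi])
  rw [sub_self, norm_zero] at h
  rw [norm_sub_rev, h]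
  ring

end Frobenius

/-! ### Rectangular diagonal matrices and their rank. -/

section Diagonal

variable {m n : ℕ}

theorem rectDiag_apply (σ : ℕ → ℝ) (i : Fin m) (j : Fin n) :
    rectDiag m n σ i j = if (i : ℕ) = (j : ℕ) then σ i else 0 := rfl

theorem rectDiag_transpose (σ : ℕ → ℝ) : (rectDiag m n σ)ᵀ = rectDiag n m σ := by
  ext i j
  simp only [transpose_apply, rectDiag_apply]
  split_ifs <;> first | omega | simp_all

/-- A small inner dimension `k` cuts the diagonal off at `k`; `h` says that nothing is lost. -/
theorem rectDiag_mul_rectDiag {k : ℕ} (σ τ : ℕ → ℝ) (h : ∀ l < min m n, k ≤ l → σ l * τ l = 0) :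
    rectDiag m k σ * rectDiag k n τ = rectDiag m n (fun l => σ l * τ l) := by
  ext i j
  simp only [mul_apply, rectDiag_apply]
  by_cases hi : (i : ℕ) < k
  · rw [Finset.sum_eq_single ⟨i, hi⟩]
    · simp
    · intro b _ hb
      rw [if_neg, zero_mul]
      exact fun h' => hb (Fin.ext h'.symm)
    · simp
  · rw [Finset.sum_eq_zero]
    · split_ifs with hij
      · exact (h _ (by omega) (by omega)).symm
      · rfl
    · intro b _
      rw [if_neg (by omega), zero_mul]

theorem rectDiag_self (σ : ℕ → ℝ) : rectDiag m m σ = diagonal fun i : Fin m => σ i := by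
  ext i j
  simp [rectDiag_apply, diagonal_apply, Fin.ext_iff]

theorem frobenius_sq_rectDiag (σ : ℕ → ℝ) (h : ∀ k, n ≤ k → σ k = 0) :
    ‖rectDiag m n σ‖ ^ 2 = ∑ i : Fin m, σ i ^ 2 := by
  rw [frobenius_sq_eq_sum]
  refine Finset.sum_congr rfl fun i _ => ?_
  simp only [rectDiag_apply]
  by_cases hi : (i : ℕ) < n
  · rw [Finset.sum_eq_single ⟨i, hi⟩]
    · simp
    · intro b _ hb
      rw [if_neg]
      · simp
      · exact fun h' => hb (Fin.ext h'.symm)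
    · simp
  · rw [h i (by omega)]
    simp

theorem rank_rectDiag_le (σ : ℕ → ℝ) {r : ℕ} (h : ∀ k, r ≤ k → σ k = 0) :
    (rectDiag m n σ).rank ≤ r := by
  have : rectDiag m n σ = rectDiag m r σ * rectDiag r n (fun _ => 1) := by
    rw [rectDiag_mul_rectDiag]
    · simp
    · intro l _ hl
      simp [h l hl]
  rw [this]
  exact (rank_mul_le_left _ _).trans (rank_le_width _)

theorem lt_rank_rectDiag {σ : ℕ → ℝ} {r : ℕ} (hr : r < min m n) (h : ∀ k ≤ r, σ k ≠ 0) :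
    r < (rectDiag m n σ).rank := by
  have h1 := rank_submatrix_le (rectDiag m n σ) (Fin.castLE (by omega : r + 1 ≤ m))
    (Fin.castLE (by omega : r + 1 ≤ n))
  have h2 : (rectDiag m n σ).submatrix (Fin.castLE (by omega : r + 1 ≤ m))
      (Fin.castLE (by omega : r + 1 ≤ n)) = diagonal fun i : Fin (r + 1) => σ i := by
    rw [← rectDiag_self]
    rfl
  rw [h2, rank_diagonal, Fintype.card_subtype, Finset.filter_true_of_mem] at h1
  · simpa using h1
  · intro i _
    exact h i (by omega)

end Diagonal

/-! ### Existence of singular value decompositions, and rank. -/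

section SVD

variable {m n : ℕ}

theorem transpose_mul_self_of_mem {U : Matrix (Fin m) (Fin m) ℝ}
    (h : U ∈ orthogonalGroup (Fin m) ℝ) : Uᵀ * U = 1 :=
  (mem_orthogonalGroup_iff' (Fin m) ℝ).1 h

theorem mul_transpose_self_of_mem {U : Matrix (Fin m) (Fin m) ℝ}
    (h : U ∈ orthogonalGroup (Fin m) ℝ) : U * Uᵀ = 1 :=
  (mem_orthogonalGroup_iff (Fin m) ℝ).1 h

theorem rank_orthogonal_mul_mul {U : Matrix (Fin m) (Fin m) ℝ} {V : Matrix (Fin n) (Fin n) ℝ}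
    (hU : U ∈ orthogonalGroup (Fin m) ℝ) (hV : V ∈ orthogonalGroup (Fin n) ℝ)
    (D : Matrix (Fin m) (Fin n) ℝ) : (U * D * Vᵀ).rank = D.rank := by
  apply le_antisymm
  · exact (rank_mul_le_left _ _).trans (rank_mul_le_right _ _)
  · have : D = Uᵀ * (U * D * Vᵀ) * V := by
      have : Uᵀ * (U * D * Vᵀ) * V = (Uᵀ * U) * D * (Vᵀ * V) := by
        simp only [Matrix.mul_assoc]
      rw [this, transpose_mul_self_of_mem hU, transpose_mul_self_of_mem hV]
      simp
    conv_lhs => rw [this]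
    exact (rank_mul_le_left _ _).trans (rank_mul_le_right _ _)

theorem IsSVD.lt_rank_iff {M : Matrix (Fin m) (Fin n) ℝ} {U σ V} (h : IsSVD M U σ V) (k : ℕ) :
    k < M.rank ↔ 0 < σ k := by
  rw [h.factorization, rank_orthogonal_mul_mul h.left_orthogonal h.right_orthogonal]
  constructor
  · intro hk
    by_contra h0
    have h1 : σ k = 0 := le_antisymm (not_lt.1 h0) (h.nonneg k)
    have := rank_rectDiag_le (m := m) (n := n) σ (r := k) fun l hl =>
      le_antisymm ((h.antitone hl).trans_eq h1) (h.nonneg l)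
    omega
  · intro hk
    apply lt_rank_rectDiag
    · by_contra h0
      exact hk.ne' (h.eq_zero k (not_lt.1 h0))
    · intro l hl
      exact (hk.trans_le (h.antitone hl)).ne'

theorem orthonormalBasis_matrix_mem (b : OrthonormalBasis (Fin m) ℝ (EuclideanSpace ℝ (Fin m))) :
    (Matrix.of fun i j => b j i) ∈ orthogonalGroup (Fin m) ℝ := by
  rw [mem_orthogonalGroup_iff']
  ext i j
  have := orthonormal_iff_ite.1 b.orthonormal i j
  simp only [PiLp.inner_apply, RCLike.inner_apply, conj_trivial] at this
  simp only [mul_apply, of_apply, one_apply]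
  rw [← this]
  exact Finset.sum_congr rfl fun _ _ => mul_comm _ _

/-- An eigenbasis `v` of `f* f` has orthogonal images of lengths `σ i`. The nonzero images,
normalized, extend to an orthonormal basis of the target. -/
theorem exists_isSVD (M : Matrix (Fin m) (Fin n) ℝ) : ∃ U σ V, IsSVD M U σ V := by
  let f : EuclideanSpace ℝ (Fin n) →ₗ[ℝ] EuclideanSpace ℝ (Fin m) := toEuclideanLin M
  have hn : Module.finrank ℝ (EuclideanSpace ℝ (Fin n)) = n := by simp
  let v := f.isSymmetric_adjoint_comp_self.eigenvectorBasis hn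
  let σ : ℕ → ℝ := f.singularValues
  have hinner (i j : Fin n) : inner ℝ (f (v i)) (f (v j)) = if i = j then σ i ^ 2 else 0 := by
    rw [← LinearMap.adjoint_inner_right]
    have h1 : LinearMap.adjoint f (f (v j)) = (σ j ^ 2) • v j := by
      have := f.isSymmetric_adjoint_comp_self.apply_eigenvectorBasis hn j
      rw [f.sq_singularValues_fin hn]
      exact this
    rw [h1, inner_smul_right, orthonormal_iff_ite.1 v.orthonormal]
    split_ifs with hij <;> simp [hij]
  have hle : Module.finrank ℝ f.range ≤ min m n := by
    refine le_min ?_ ?_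
    · exact (Submodule.finrank_le _).trans_eq (by simp)
    · exact (LinearMap.finrank_range_le f).trans_eq hn
  have hzero (k : ℕ) (hk : min m n ≤ k) : σ k = 0 :=
    f.singularValues_eq_zero_iff_le_finrank_range.2 (hle.trans hk)
  -- The value `0` is harmless: for `i ≥ n` one has `σ i = 0`, so `i` is outside `s`.
  let u : Fin m → EuclideanSpace ℝ (Fin m) := fun i =>
    if h : (i : ℕ) < n then (σ i)⁻¹ • f (v ⟨i, h⟩) else 0
  let s : Set (Fin m) := {i | σ i ≠ 0}
  have hu : Orthonormal ℝ (s.domRestrict u) := by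
    rw [orthonormal_iff_ite]
    rintro ⟨i, hi⟩ ⟨j, hj⟩
    have hin : (i : ℕ) < n := by
      by_contra h
      exact hi (hzero _ (by omega))
    have hjn : (j : ℕ) < n := by
      by_contra h
      exact hj (hzero _ (by omega))
    have hi' : σ i ≠ 0 := hi
    simp only [Set.domRestrict_apply, u, hin, hjn, dite_true, inner_smul_left, inner_smul_right,
      hinner, conj_trivial, Subtype.mk.injEq, Fin.ext_iff]
    split_ifs with hij
    · rw [← hij]
      field_simp
    · simp
  obtain ⟨b, hb⟩ := hu.exists_orthonormalBasis_extension_of_card_eq (by simp)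
  refine ⟨Matrix.of fun i j => b j i, σ, Matrix.of fun i j => v j i,
    orthonormalBasis_matrix_mem b, orthonormalBasis_matrix_mem v, f.singularValues_nonneg,
    f.singularValues_antitone, hzero, ?_⟩
  have hV := orthonormalBasis_matrix_mem v
  set V : Matrix (Fin n) (Fin n) ℝ := Matrix.of fun i j => v j i with hVdef
  have key : M * V = (Matrix.of fun i j => b j i) * rectDiag m n σ := by
    ext i j
    have hl : (M * V) i j = f (v j) i := by
      simp [f, mul_apply, hVdef, toLpLin_apply, mulVec, dotProduct]
    rw [hl, mul_apply]
    simp only [rectDiag_apply, of_apply]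
    by_cases hj : σ j = 0
    · have : f (v j) = 0 := by
        have := hinner j j
        rw [if_pos rfl, hj] at this
        simpa using this
      rw [this, Finset.sum_eq_zero]
      · rfl
      · intro x _
        split_ifs with hx
        · rw [hx, hj, mul_zero]
        · rw [mul_zero]
    · have hjm : (j : ℕ) < m := by
        by_contra h
        exact hj (hzero _ (by omega))
      rw [Finset.sum_eq_single ⟨j, hjm⟩]
      · rw [hb ⟨j, hjm⟩ hj]
        simp only [u, j.2, dite_true, if_true, Fin.eta, PiLp.smul_apply, smul_eq_mul]
        field_simp
      · intro x _ hx
        rw [if_neg, mul_zero]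
        exact fun h => hx (Fin.ext h)
      · simp
  rw [← key, Matrix.mul_assoc, mul_transpose_self_of_mem hV, Matrix.mul_one]

end SVD

/-! ### The extremal problem for weights in `[0, 1]` of bounded total. -/

section WeightedSum

variable {m : ℕ}

theorem sum_indicator_lt_le (m r : ℕ) :
    ∑ i : Fin m, (if (i : ℕ) < r then (1 : ℝ) else 0) ≤ r := by
  rw [Fin.sum_univ_eq_sum_range (fun i => if i < r then (1 : ℝ) else 0), Finset.sum_boole]
  exact_mod_cast (Finset.card_le_card fun x hx => by simp_all).trans_eq (Finset.card_range r)

theorem sum_indicator_lt {r : ℕ} (h : r ≤ m) :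
    ∑ i : Fin m, (if (i : ℕ) < r then (1 : ℝ) else 0) = r := by
  rw [Fin.sum_univ_eq_sum_range (fun i => if i < r then (1 : ℝ) else 0), Finset.sum_boole]
  have : (Finset.range m).filter (· < r) = Finset.range r := by
    ext x
    simp only [Finset.mem_filter, Finset.mem_range]
    omega
  rw [this, Finset.card_range]

variable {q : Fin m → ℝ} {a : ℕ → ℝ} {r : ℕ}

theorem weighted_term_nonneg (h0 : ∀ i, 0 ≤ q i) (h1 : ∀ i, q i ≤ 1) (ha : Antitone a)
    (i : Fin m) : 0 ≤ ((if (i : ℕ) < r then 1 else 0) - q i) * (a i - a r) := by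
  split_ifs with hi
  · exact mul_nonneg (by linarith [h1 i]) (by linarith [ha hi.le])
  · exact mul_nonneg_of_nonpos_of_nonpos (by linarith [h0 i]) (by linarith [ha (not_lt.1 hi)])

/-- Comparing with the threshold `a r` splits the deficit into two parts, each nonnegative for
admissible weights. -/
theorem weighted_sum_eq (q : Fin m → ℝ) (a : ℕ → ℝ) (r : ℕ) :
    ∑ i : Fin m, (if (i : ℕ) < r then 1 else 0) * a i - ∑ i : Fin m, q i * a i =
      ∑ i : Fin m, ((if (i : ℕ) < r then 1 else 0) - q i) * (a i - a r) +
        (∑ i : Fin m, (if (i : ℕ) < r then (1 : ℝ) else 0) - ∑ i, q i) * a r := by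
  rw [← Finset.sum_sub_distrib, ← Finset.sum_sub_distrib, Finset.sum_mul,
    ← Finset.sum_add_distrib]
  exact Finset.sum_congr rfl fun i _ => by ring

theorem weighted_remainder_nonneg (hq : ∑ i, q i ≤ r) (hn : ∀ k, 0 ≤ a k)
    (hz : ∀ k, m ≤ k → a k = 0) :
    0 ≤ (∑ i : Fin m, (if (i : ℕ) < r then (1 : ℝ) else 0) - ∑ i, q i) * a r := by
  rcases le_total m r with h | h
  · rw [hz r h, mul_zero]
  · rw [sum_indicator_lt h]
    exact mul_nonneg (by linarith) (hn r)

theorem weighted_sum_le (h0 : ∀ i, 0 ≤ q i) (h1 : ∀ i, q i ≤ 1) (hq : ∑ i, q i ≤ r)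
    (ha : Antitone a) (hn : ∀ k, 0 ≤ a k) (hz : ∀ k, m ≤ k → a k = 0) :
    ∑ i : Fin m, q i * a i ≤ ∑ i : Fin m, (if (i : ℕ) < r then 1 else 0) * a i := by
  have := weighted_sum_eq q a r
  have := Finset.sum_nonneg fun i (_ : i ∈ Finset.univ) => weighted_term_nonneg (r := r) h0 h1 ha i
  have := weighted_remainder_nonneg hq hn hz
  linarith

/-- Equality kills each term of the deficit. The gap then forces weight one below `r`, which
exhausts the total. For `r = 0` the gap reads `a 0 < a 0` and is impossible. -/
theorem eq_indicator_of_weighted_sum_eq (h0 : ∀ i, 0 ≤ q i) (h1 : ∀ i, q i ≤ 1)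
    (hq : ∑ i, q i ≤ r) (ha : Antitone a) (hn : ∀ k, 0 ≤ a k) (hz : ∀ k, m ≤ k → a k = 0)
    (hgap : a r < a (r - 1))
    (heq : ∑ i : Fin m, (if (i : ℕ) < r then 1 else 0) * a i ≤ ∑ i : Fin m, q i * a i) (i : Fin m) :
    q i = if (i : ℕ) < r then 1 else 0 := by
  have hsum : ∑ i : Fin m, ((if (i : ℕ) < r then 1 else 0) - q i) * (a i - a r) = 0 := by
    have := weighted_sum_eq q a r
    have := Finset.sum_nonneg fun i (_ : i ∈ Finset.univ) =>
      weighted_term_nonneg (r := r) h0 h1 ha i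
    have := weighted_remainder_nonneg hq hn hz
    linarith
  rw [Finset.sum_eq_zero_iff_of_nonneg fun i _ => weighted_term_nonneg h0 h1 ha i] at hsum
  have hlt (j : Fin m) (hj : (j : ℕ) < r) : q j = 1 := by
    have h := hsum j (Finset.mem_univ j)
    rw [if_pos hj, mul_eq_zero] at h
    have := ha (show (j : ℕ) ≤ r - 1 by omega)
    rcases h with h | h <;> linarith
  have hle (j : Fin m) : (if (j : ℕ) < r then 1 else 0) ≤ q j := by
    split_ifs with hj
    · exact (hlt j hj).ge
    · exact h0 j
  have hrm : r ≤ m := by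
    by_contra h
    have := hz (r - 1) (by omega)
    linarith [hn r]
  have htot : ∑ i : Fin m, (if (i : ℕ) < r then (1 : ℝ) else 0) = ∑ i, q i :=
    le_antisymm (Finset.sum_le_sum fun j _ => hle j) (by rwa [sum_indicator_lt hrm])
  exact ((Finset.sum_eq_sum_iff_of_le fun j _ => hle j).1 htot i (Finset.mem_univ i)).symm

end WeightedSum

/-- Orthogonal projections of trace (that is, rank) at most `r`. -/
structure IsProjectionLE {m : ℕ} (P : Matrix (Fin m) (Fin m) ℝ) (r : ℕ) : Prop where
  symm : Pᵀ = P
  idem : P * P = P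
  trace_le : P.trace ≤ r

/-- The coordinate projection onto the first `r` coordinates. -/
def leadProj (m r : ℕ) : Matrix (Fin m) (Fin m) ℝ :=
  diagonal fun i => if (i : ℕ) < r then 1 else 0

/-! ### Projections of bounded trace as a substitute for the rank constraint. -/

section Projection

theorem leadProj_zero (m : ℕ) : leadProj m 0 = 0 := by
  ext i j
  simp [leadProj, diagonal_apply]

variable {m n : ℕ} {r : ℕ}

theorem IsProjectionLE.conj {P U : Matrix (Fin m) (Fin m) ℝ} (hP : IsProjectionLE P r)
    (hU : Uᵀ * U = 1) : IsProjectionLE (U * P * Uᵀ) r where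
  symm := by simp only [transpose_mul, transpose_transpose, hP.symm, Matrix.mul_assoc]
  idem := by
    have : U * P * Uᵀ * (U * P * Uᵀ) = U * (P * ((Uᵀ * U) * P)) * Uᵀ := by
      simp only [Matrix.mul_assoc]
    rw [this, hU, Matrix.one_mul, hP.idem]
  trace_le := by
    rw [trace_mul_comm, ← Matrix.mul_assoc, hU, Matrix.one_mul]
    exact hP.trace_le

theorem IsProjectionLE.conj_transpose {P U : Matrix (Fin m) (Fin m) ℝ} (hP : IsProjectionLE P r)
    (hU : U ∈ orthogonalGroup (Fin m) ℝ) : IsProjectionLE (Uᵀ * P * U) r := by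
  simpa using hP.conj (U := Uᵀ) (by simpa using mul_transpose_self_of_mem hU)

theorem isProjectionLE_diagonal {w : Fin m → ℝ} (hw : ∀ i, w i * w i = w i)
    (hr : ∑ i, w i ≤ r) : IsProjectionLE (diagonal w) r where
  symm := diagonal_transpose w
  idem := by
    rw [diagonal_mul_diagonal]
    exact congrArg diagonal (funext hw)
  trace_le := by rwa [trace_diagonal]

theorem isProjectionLE_leadProj (m r : ℕ) : IsProjectionLE (leadProj m r) r :=
  isProjectionLE_diagonal (fun i => by split_ifs <;> simp) (sum_indicator_lt_le m r)

/-- This is the diagonal of `P = Pᵀ * P`; it puts the diagonal entries in `[0, 1]`, so that they can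
serve as weights. -/
theorem IsProjectionLE.diag_eq_sum {P : Matrix (Fin m) (Fin m) ℝ} (hP : IsProjectionLE P r)
    (j : Fin m) : P j j = ∑ i, P i j ^ 2 := by
  conv_lhs => rw [← hP.idem]
  rw [mul_apply]
  refine Finset.sum_congr rfl fun i _ => ?_
  conv_lhs => rw [← hP.symm, transpose_apply, hP.symm]
  ring

theorem IsProjectionLE.diag_nonneg {P : Matrix (Fin m) (Fin m) ℝ} (hP : IsProjectionLE P r)
    (j : Fin m) : 0 ≤ P j j := by
  rw [hP.diag_eq_sum]
  positivity

theorem IsProjectionLE.diag_le_one {P : Matrix (Fin m) (Fin m) ℝ} (hP : IsProjectionLE P r)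
    (j : Fin m) : P j j ≤ 1 := by
  have h := hP.diag_eq_sum j
  have := Finset.single_le_sum (f := fun i => P i j ^ 2) (fun i _ => sq_nonneg _)
    (Finset.mem_univ j)
  nlinarith [hP.diag_nonneg j]

/-- When `P j j` is `0` or `1`, it equals its own square, which leaves nothing for the other entries
of column `j`. -/
theorem IsProjectionLE.eq_leadProj {P : Matrix (Fin m) (Fin m) ℝ} (hP : IsProjectionLE P r) {k : ℕ}
    (h : ∀ i : Fin m, P i i = if (i : ℕ) < k then 1 else 0) : P = leadProj m k := by
  ext i j
  rw [leadProj, diagonal_apply]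
  split_ifs with hij hi
  · rw [← hij, h, if_pos hi]
  · rw [← hij, h, if_neg hi]
  · have hs := hP.diag_eq_sum j
    rw [← Finset.add_sum_erase _ _ (Finset.mem_univ j)] at hs
    have h1 : P j j = P j j ^ 2 := by
      rw [h]
      split_ifs <;> simp
    have h2 : P i j ^ 2 ≤ ∑ l ∈ Finset.univ.erase j, P l j ^ 2 :=
      Finset.single_le_sum (f := fun l => P l j ^ 2) (fun l _ => sq_nonneg _)
        (Finset.mem_erase.2 ⟨hij, Finset.mem_univ i⟩)
    have h3 : P i j ^ 2 = 0 := le_antisymm (by linarith) (sq_nonneg _)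
    simpa using h3

theorem frobenius_sq_projection_mul {P U : Matrix (Fin m) (Fin m) ℝ} (hP : IsProjectionLE P r)
    {V : Matrix (Fin n) (Fin n) ℝ} (hU : U ∈ orthogonalGroup (Fin m) ℝ)
    (hV : V ∈ orthogonalGroup (Fin n) ℝ) {σ : ℕ → ℝ} (hσ : ∀ k, n ≤ k → σ k = 0) :
    ‖P * (U * rectDiag m n σ * Vᵀ)‖ ^ 2 = ∑ i : Fin m, (Uᵀ * P * U) i i * σ i ^ 2 := by
  have hQ := hP.conj_transpose hU
  set Q := Uᵀ * P * U with hQdef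
  have h1 : P * (U * rectDiag m n σ * Vᵀ) = U * (Q * rectDiag m n σ) * Vᵀ := by
    have : U * (Q * rectDiag m n σ) * Vᵀ = (U * Uᵀ) * P * U * rectDiag m n σ * Vᵀ := by
      simp only [hQdef, Matrix.mul_assoc]
    rw [this, mul_transpose_self_of_mem hU]
    simp only [Matrix.one_mul, Matrix.mul_assoc]
  rw [h1, frobenius_sq_isometry (transpose_mul_self_of_mem hU) (transpose_mul_self_of_mem hV),
    frobenius_sq_eq_trace]
  have h2 : (Q * rectDiag m n σ)ᵀ * (Q * rectDiag m n σ) =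
      (rectDiag m n σ)ᵀ * (Q * rectDiag m n σ) := by
    rw [transpose_mul, hQ.symm, Matrix.mul_assoc, ← Matrix.mul_assoc Q Q, hQ.idem]
  rw [h2, trace_mul_comm, Matrix.mul_assoc, rectDiag_transpose, rectDiag_mul_rectDiag, rectDiag_self,
    trace]
  · refine Finset.sum_congr rfl fun i _ => ?_
    rw [diag_apply, mul_diagonal, pow_two]
  · intro l _ hl
    rw [hσ l hl, zero_mul]

theorem leadProj_mul_rectDiag (σ : ℕ → ℝ) :
    leadProj m r * rectDiag m n σ = rectDiag m n (fun k => if k < r then σ k else 0) := by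
  ext i j
  rw [leadProj, diagonal_mul, rectDiag_apply, rectDiag_apply]
  split_ifs <;> simp

theorem truncation_eq_projection_mul {M : Matrix (Fin m) (Fin n) ℝ} {U σ V} (h : IsSVD M U σ V)
    (r : ℕ) : truncation U σ V r = U * leadProj m r * Uᵀ * M := by
  rw [h.factorization]
  have : U * leadProj m r * Uᵀ * (U * rectDiag m n σ * Vᵀ) =
      U * leadProj m r * (Uᵀ * U) * rectDiag m n σ * Vᵀ := by
    simp only [Matrix.mul_assoc]
  rw [this, transpose_mul_self_of_mem h.left_orthogonal, Matrix.mul_one, truncation,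
    ← leadProj_mul_rectDiag]
  simp only [Matrix.mul_assoc]

theorem truncation_eq_self {M : Matrix (Fin m) (Fin n) ℝ} {U σ V} (h : IsSVD M U σ V)
    (hr : σ r = 0) : truncation U σ V r = M := by
  have : (fun k => if k < r then σ k else 0) = σ := by
    funext k
    split_ifs with hk
    · rfl
    · exact le_antisymm (h.nonneg k) ((h.antitone (not_lt.1 hk)).trans_eq hr)
  rw [truncation, this, ← h.factorization]

theorem rank_truncation_le (U : Matrix (Fin m) (Fin m) ℝ) (σ : ℕ → ℝ)
    (V : Matrix (Fin n) (Fin n) ℝ) (r : ℕ) : (truncation U σ V r).rank ≤ r := by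
  refine (rank_mul_le_left _ _).trans ((rank_mul_le_right _ _).trans ?_)
  exact rank_rectDiag_le _ fun k hk => if_neg (not_lt.2 hk)

/-- The SVD of `T` itself supplies `U`: truncating it at `r` changes nothing. -/
theorem exists_lead_projection {T : Matrix (Fin m) (Fin n) ℝ} (hT : T.rank ≤ r) :
    ∃ U ∈ orthogonalGroup (Fin m) ℝ, U * leadProj m r * Uᵀ * T = T := by
  obtain ⟨U, σ, V, h⟩ := exists_isSVD T
  refine ⟨U, h.left_orthogonal, ?_⟩
  rw [← truncation_eq_projection_mul h, truncation_eq_self h]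
  have := (h.lt_rank_iff r).not.1 (not_lt.2 hT)
  exact le_antisymm (not_lt.1 this) (h.nonneg r)

theorem isProjectionLE_lead {U : Matrix (Fin m) (Fin m) ℝ} (hU : U ∈ orthogonalGroup (Fin m) ℝ)
    (r : ℕ) : IsProjectionLE (U * leadProj m r * Uᵀ) r :=
  (isProjectionLE_leadProj m r).conj (transpose_mul_self_of_mem hU)

end Projection

/-! ### The Eckart–Young theorem with uniqueness. -/

section EckartYoung

variable {m n r : ℕ} {M T : Matrix (Fin m) (Fin n) ℝ}
  {U : Matrix (Fin m) (Fin m) ℝ} {σ : ℕ → ℝ} {V : Matrix (Fin n) (Fin n) ℝ}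

theorem IsSVD.eq_zero_left (h : IsSVD M U σ V) {k : ℕ} (hk : m ≤ k) : σ k = 0 :=
  h.eq_zero k ((min_le_left _ _).trans hk)

theorem IsSVD.eq_zero_right (h : IsSVD M U σ V) {k : ℕ} (hk : n ≤ k) : σ k = 0 :=
  h.eq_zero k ((min_le_right _ _).trans hk)

theorem IsSVD.antitone_sq (h : IsSVD M U σ V) : Antitone fun k => σ k ^ 2 :=
  fun _ b hab => pow_le_pow_left₀ (h.nonneg b) (h.antitone hab) 2

theorem frobenius_sq_truncation (h : IsSVD M U σ V) (r : ℕ) :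
    ‖truncation U σ V r‖ ^ 2 = ∑ i : Fin m, (if (i : ℕ) < r then 1 else 0) * σ i ^ 2 := by
  rw [truncation, frobenius_sq_isometry (transpose_mul_self_of_mem h.left_orthogonal)
    (transpose_mul_self_of_mem h.right_orthogonal), frobenius_sq_rectDiag]
  · refine Finset.sum_congr rfl fun i _ => ?_
    split_ifs <;> simp
  · intro k hk
    rw [h.eq_zero_right hk, ite_self]

theorem frobenius_sq_projection_mul_le (h : IsSVD M U σ V) {P : Matrix (Fin m) (Fin m) ℝ}
    (hP : IsProjectionLE P r) : ‖P * M‖ ^ 2 ≤ ‖truncation U σ V r‖ ^ 2 := by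
  have hQ := hP.conj_transpose h.left_orthogonal
  rw [frobenius_sq_truncation h, h.factorization, frobenius_sq_projection_mul hP h.left_orthogonal
    h.right_orthogonal fun k => h.eq_zero_right]
  exact weighted_sum_le (a := fun k => σ k ^ 2) hQ.diag_nonneg hQ.diag_le_one hQ.trace_le
    h.antitone_sq (fun k => sq_nonneg _) fun k hk => by simp [h.eq_zero_left hk]

theorem projection_mul_eq_truncation (h : IsSVD M U σ V) {P : Matrix (Fin m) (Fin m) ℝ}
    (hP : IsProjectionLE P r) (hgap : σ r < σ (r - 1))
    (heq : ‖truncation U σ V r‖ ^ 2 ≤ ‖P * M‖ ^ 2) : P * M = truncation U σ V r := by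
  have hQ := hP.conj_transpose h.left_orthogonal
  rw [frobenius_sq_truncation h, h.factorization, frobenius_sq_projection_mul hP h.left_orthogonal
    h.right_orthogonal fun k => h.eq_zero_right] at heq
  have hQr := hQ.eq_leadProj <| eq_indicator_of_weighted_sum_eq (a := fun k => σ k ^ 2)
    hQ.diag_nonneg hQ.diag_le_one hQ.trace_le h.antitone_sq (fun k => sq_nonneg _)
    (fun k hk => by simp [h.eq_zero_left hk]) (pow_lt_pow_left₀ hgap (h.nonneg r) two_ne_zero) heq
  have : P = U * leadProj m r * Uᵀ := by
    have h1 : U * (Uᵀ * P * U) * Uᵀ = (U * Uᵀ) * P * (U * Uᵀ) := by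
      simp only [Matrix.mul_assoc]
    rw [mul_transpose_self_of_mem h.left_orthogonal, Matrix.one_mul, Matrix.mul_one] at h1
    rw [← hQr, h1]
  rw [truncation_eq_projection_mul h, ← this]

theorem frobenius_sq_sub_truncation (h : IsSVD M U σ V) (r : ℕ) :
    ‖M - truncation U σ V r‖ ^ 2 = ‖M‖ ^ 2 - ‖truncation U σ V r‖ ^ 2 := by
  have hP := isProjectionLE_lead h.left_orthogonal r
  have := frobenius_sq_projection_add hP.symm hP.idem M
  rw [← truncation_eq_projection_mul h, norm_sub_rev] at this
  linarith

/-- If `P` fixes `T`, the squared error is at least `‖M‖ ^ 2 - ‖P * M‖ ^ 2`, and truncation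
maximizes the subtracted term. -/
theorem isBestRankApprox_truncation (h : IsSVD M U σ V) (r : ℕ) :
    IsBestRankApprox M r (truncation U σ V r) := by
  refine ⟨rank_truncation_le _ _ _ _, fun T hT => ?_⟩
  obtain ⟨W, hW, hWT⟩ := exists_lead_projection hT
  have hP := isProjectionLE_lead hW r
  have h1 := frobenius_sq_sub_projection hP.symm M hWT
  have h2 := frobenius_sq_projection_mul_le h hP
  have h3 := frobenius_sq_sub_truncation h r
  refine le_of_sq_le_sq ?_ (norm_nonneg _)
  nlinarith [sq_nonneg ‖W * leadProj m r * Wᵀ * M - T‖]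

theorem IsBestRankApprox.norm_sub_eq {T T' : Matrix (Fin m) (Fin n) ℝ}
    (h : IsBestRankApprox M r T) (h' : IsBestRankApprox M r T') : ‖M - T‖ = ‖M - T'‖ :=
  le_antisymm (h.2 _ h'.1) (h'.2 _ h.1)

/-- A best approximation is the compression of `M` to any projection of rank at most `r` that fixes
it. -/
theorem IsBestRankApprox.projection_mul_eq (hT : IsBestRankApprox M r T)
    {P : Matrix (Fin m) (Fin m) ℝ} (hP : IsProjectionLE P r) (hPT : P * T = T) : P * M = T := by
  obtain ⟨U, σ, V, h⟩ := exists_isSVD M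
  have h1 := frobenius_sq_sub_projection hP.symm M hPT
  have h2 := frobenius_sq_projection_mul_le h hP
  have h3 := frobenius_sq_sub_truncation h r
  rw [← hT.norm_sub_eq (isBestRankApprox_truncation h r)] at h3
  have : ‖P * M - T‖ ^ 2 = 0 := le_antisymm (by linarith) (sq_nonneg _)
  rw [pow_eq_zero_iff two_ne_zero, norm_eq_zero, sub_eq_zero] at this
  exact this

theorem IsBestRankApprox.frobenius_sq_sub (hT : IsBestRankApprox M r T) :
    ‖M - T‖ ^ 2 = ‖M‖ ^ 2 - ‖T‖ ^ 2 := by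
  obtain ⟨W, hW, hWT⟩ := exists_lead_projection hT.1
  have hP := isProjectionLE_lead hW r
  have h := frobenius_sq_sub_projection hP.symm M hWT
  rw [hT.projection_mul_eq hP hWT, sub_self, norm_zero] at h
  linarith

theorem IsBestRankApprox.norm_eq_truncation (hT : IsBestRankApprox M r T) (h : IsSVD M U σ V) :
    ‖T‖ ^ 2 = ‖truncation U σ V r‖ ^ 2 := by
  have h1 := hT.frobenius_sq_sub
  have h2 := frobenius_sq_sub_truncation h r
  rw [hT.norm_sub_eq (isBestRankApprox_truncation h r)] at h1
  linarith

theorem IsBestRankApprox.projection_mul_le (hT : IsBestRankApprox M r T)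
    {P : Matrix (Fin m) (Fin m) ℝ} (hP : IsProjectionLE P r) : ‖P * M‖ ^ 2 ≤ ‖T‖ ^ 2 := by
  obtain ⟨U, σ, V, h⟩ := exists_isSVD M
  rw [hT.norm_eq_truncation h]
  exact frobenius_sq_projection_mul_le h hP

theorem IsBestRankApprox.eq_truncation (hT : IsBestRankApprox M r T) (h : IsSVD M U σ V)
    (hgap : r = 0 ∨ σ r < σ (r - 1) ∨ σ r = 0) : T = truncation U σ V r := by
  rcases hgap with rfl | hgap | hzero
  · obtain ⟨W, hW, hWT⟩ := exists_lead_projection hT.1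
    rw [truncation_eq_projection_mul h, ← hWT, leadProj_zero]
    simp only [Matrix.mul_zero, Matrix.zero_mul]
  · obtain ⟨W, hW, hWT⟩ := exists_lead_projection hT.1
    have hP := isProjectionLE_lead hW r
    have h1 := hT.projection_mul_eq hP hWT
    rw [← h1]
    refine projection_mul_eq_truncation h hP hgap ?_
    rw [h1, hT.norm_eq_truncation h]
  · have h1 := hT.norm_sub_eq (isBestRankApprox_truncation h r)
    rw [truncation_eq_self h hzero, sub_self, norm_zero, norm_eq_zero, sub_eq_zero] at h1
    rw [truncation_eq_self h hzero, h1]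

end EckartYoung

/-! ### Every best approximation is a truncation of some SVD. -/

section Characterization

variable {m n r : ℕ} {M T : Matrix (Fin m) (Fin n) ℝ}

/-- A projection fixing `T` sends `M + T` to `T + T`, so the truncation has norm at least `2 * ‖T‖`.
A projection `P` fixing the truncation gives the reverse bound, since `‖P * M‖` and `‖P * T‖` are at
most `‖T‖`. Equality in the parallelogram law forces `P * M = P * T = T`. -/
theorem IsBestRankApprox.truncation_add_self (hT : IsBestRankApprox M r T)
    {U : Matrix (Fin m) (Fin m) ℝ} {σ : ℕ → ℝ} {V : Matrix (Fin n) (Fin n) ℝ}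
    (h : IsSVD (M + T) U σ V) : truncation U σ V r = T + T := by
  have hbest := isBestRankApprox_truncation h r
  obtain ⟨W, hW, hWT⟩ := exists_lead_projection hT.1
  have hQ := isProjectionLE_lead hW r
  have hlow := frobenius_sq_projection_mul_le h hQ
  rw [Matrix.mul_add, hT.projection_mul_eq hQ hWT, hWT] at hlow
  obtain ⟨Z, hZ, hZT⟩ := exists_lead_projection hbest.1
  have hP := isProjectionLE_lead hZ r
  have hPN := hbest.projection_mul_eq hP hZT
  set P := Z * leadProj m r * Zᵀ
  have hadd (X Y : Matrix (Fin m) (Fin n) ℝ) :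
      ‖X + Y‖ ^ 2 = 2 * ‖X‖ ^ 2 + 2 * ‖Y‖ ^ 2 - ‖X - Y‖ ^ 2 := by
    have h1 := RankApprox.frobenius_sq_sub X Y
    have h2 := RankApprox.frobenius_sq_sub X (-Y)
    rw [sub_neg_eq_add, Matrix.mul_neg, trace_neg, norm_neg] at h2
    linarith
  rw [← hPN, Matrix.mul_add, hadd, hadd, sub_self, norm_zero] at hlow
  have h1 := hT.projection_mul_le hP
  have h2 := frobenius_sq_projection_add hP.symm hP.idem T
  have h3 : ‖P * T - T‖ ^ 2 = 0 := by nlinarith [sq_nonneg ‖P * T - T‖, sq_nonneg ‖P * M - P * T‖]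
  have h4 : ‖P * M - P * T‖ ^ 2 = 0 := by
    nlinarith [sq_nonneg ‖P * T - T‖, sq_nonneg ‖P * M - P * T‖]
  rw [pow_eq_zero_iff two_ne_zero, norm_eq_zero, sub_eq_zero] at h3 h4
  rw [← hPN, Matrix.mul_add, h4, h3]

theorem sum_single_mul {c : ℕ} (hc : c < m) (f : ℕ → ℝ) :
    ∑ i : Fin m, (if (i : ℕ) = c then 1 else 0) * f i = f c := by
  rw [Finset.sum_eq_single ⟨c, hc⟩]
  · simp
  · intro b _ hb
    rw [if_neg, zero_mul]
    exact fun h => hb (Fin.ext h)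
  · simp

theorem IsBestRankApprox.diag_succ_le {k : ℕ} {U : Matrix (Fin m) (Fin m) ℝ}
    {V : Matrix (Fin n) (Fin n) ℝ} {w : ℕ → ℝ} (hU : U ∈ orthogonalGroup (Fin m) ℝ)
    (hV : V ∈ orthogonalGroup (Fin n) ℝ) (h0 : ∀ i, 0 ≤ w i) (hz : ∀ i, min m n ≤ i → w i = 0)
    (hT : IsBestRankApprox (U * rectDiag m n w * Vᵀ) (k + 1) (truncation U w V (k + 1))) :
    w (k + 1) ≤ w k := by
  rcases le_or_gt m (k + 1) with hk | hk
  · rw [hz _ ((min_le_left _ _).trans hk)]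
    exact h0 k
  have hz' (i : ℕ) (hi : n ≤ i) : w i = 0 := hz i ((min_le_right _ _).trans hi)
  -- Exchange coordinate `k` for `k + 1` in the leading projection; optimality of the truncation
  -- says that this cannot gain.
  let χ : Fin m → ℝ := fun i =>
    (if (i : ℕ) < k then 1 else 0) + (if (i : ℕ) = k + 1 then 1 else 0)
  have hχ : IsProjectionLE (diagonal χ) (k + 1) := by
    refine isProjectionLE_diagonal (fun i => ?_) ?_
    · simp only [χ]
      split_ifs <;> first | omega | norm_num
    · have h1 := sum_single_mul hk (fun _ => 1)
      simp only [mul_one] at h1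
      rw [Finset.sum_add_distrib, h1]
      push_cast
      linarith [sum_indicator_lt_le m k]
  have h1 := hT.projection_mul_le (hχ.conj (transpose_mul_self_of_mem hU))
  rw [frobenius_sq_projection_mul (hχ.conj (transpose_mul_self_of_mem hU)) hU hV hz', truncation,
    frobenius_sq_isometry (transpose_mul_self_of_mem hU) (transpose_mul_self_of_mem hV),
    frobenius_sq_rectDiag _ (fun i hi => by simp [hz' i hi])] at h1
  have h2 : Uᵀ * (U * diagonal χ * Uᵀ) * U = diagonal χ := by
    have : Uᵀ * (U * diagonal χ * Uᵀ) * U = (Uᵀ * U) * diagonal χ * (Uᵀ * U) := by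
      simp only [Matrix.mul_assoc]
    rw [this, transpose_mul_self_of_mem hU, Matrix.one_mul, Matrix.mul_one]
  have h3 : ∑ i : Fin m, diagonal χ i i * w i ^ 2 =
      ∑ i : Fin m, (if (i : ℕ) < k then 1 else 0) * w i ^ 2 + w (k + 1) ^ 2 := by
    rw [← sum_single_mul hk (fun i => w i ^ 2), ← Finset.sum_add_distrib]
    refine Finset.sum_congr rfl fun i _ => ?_
    rw [diagonal_apply_eq]
    ring
  have h4 : ∑ i : Fin m, (if (i : ℕ) < k + 1 then w i else 0) ^ 2 =
      ∑ i : Fin m, (if (i : ℕ) < k then 1 else 0) * w i ^ 2 + w k ^ 2 := by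
    rw [← sum_single_mul (m := m) (c := k) (by omega) (fun i => w i ^ 2), ← Finset.sum_add_distrib]
    refine Finset.sum_congr rfl fun i _ => ?_
    split_ifs <;> first | omega | simp
  rw [h2, h3, h4] at h1
  exact le_of_sq_le_sq (by linarith) (h0 k)

/-- Every best approximation of rank at most `r` is the truncation of some singular value
decomposition. -/
theorem IsBestRankApprox.exists_isSVD (hT : IsBestRankApprox M r T) :
    ∃ U σ V, IsSVD M U σ V ∧ truncation U σ V r = T := by
  obtain ⟨U, σ, V, h⟩ := RankApprox.exists_isSVD (M + T)
  -- As `M + T` truncates to `2 T`, halving the first `r` entries gives `T`, and subtracting `T`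
  -- from `M + T` leaves the diagonal `w`.
  let w : ℕ → ℝ := fun k => if k < r then σ k / 2 else σ k
  have hdouble := hT.truncation_add_self h
  have hT' : truncation U w V r = T := by
    have h1 : rectDiag m n (fun k => if k < r then σ k else 0) =
        (2 : ℝ) • rectDiag m n (fun k => if k < r then w k else 0) := by
      ext i j
      simp only [rectDiag_apply, Matrix.smul_apply, smul_eq_mul, w]
      split_ifs <;> ring
    have h2 : truncation U σ V r = (2 : ℝ) • truncation U w V r := by
      rw [truncation, h1, truncation, Matrix.mul_smul, Matrix.smul_mul]
    rw [h2, ← two_smul ℝ T] at hdouble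
    exact smul_right_injective _ (two_ne_zero' ℝ) hdouble
  have hM : M = U * rectDiag m n w * Vᵀ := by
    have h1 : rectDiag m n w = rectDiag m n σ - rectDiag m n (fun k => if k < r then w k else 0) := by
      ext i j
      simp only [rectDiag_apply, Matrix.sub_apply, w]
      split_ifs <;> ring
    rw [h1, Matrix.mul_sub, Matrix.sub_mul, ← h.factorization, ← truncation, hT', add_sub_cancel_right]
  have h0 (k : ℕ) : 0 ≤ w k := by
    have := h.nonneg k
    simp only [w]
    split_ifs <;> linarith
  have hz (k : ℕ) (hk : min m n ≤ k) : w k = 0 := by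
    simp [w, h.eq_zero k hk]
  refine ⟨U, w, V, ⟨h.left_orthogonal, h.right_orthogonal, h0, ?_, hz, hM⟩, hT'⟩
  refine antitone_nat_of_succ_le fun k => ?_
  have hs := h.antitone (Nat.le_succ k)
  -- Halving can break the order only between `r - 1` and `r`, where optimality of `T` restores it.
  rcases lt_trichotomy (k + 1) r with hk | rfl | hk
  · simp only [w, hk, (Nat.lt_succ_self k).trans hk, if_true]
    linarith
  · refine IsBestRankApprox.diag_succ_le h.left_orthogonal h.right_orthogonal h0 hz ?_
    rwa [hT', ← hM]
  · simp only [w]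
    rwa [if_neg (by omega), if_neg (by omega)]

end Characterization

/-! ### Minimizing a continuous function over best approximations. -/

section Compactness

variable {m n : ℕ}

/-- A continuous function attains its minimum on the set of best approximations. -/
theorem exists_isBestRankApprox_minimizing (M : Matrix (Fin m) (Fin n) ℝ) (r : ℕ)
    {φ : Matrix (Fin m) (Fin n) ℝ → ℝ} (hφ : Continuous φ) :
    ∃ T, IsBestRankApprox M r T ∧ ∀ T', IsBestRankApprox M r T' → φ T ≤ φ T' := by
  obtain ⟨U₀, σ₀, V₀, h₀⟩ := exists_isSVD M
  set T₀ := truncation U₀ σ₀ V₀ r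
  have hT₀ : IsBestRankApprox M r T₀ := isBestRankApprox_truncation h₀ r
  -- Carrying an orthogonal witness along turns the rank bound into a polynomial equation, so
  -- closedness is immediate.
  let K : Set (Matrix (Fin m) (Fin m) ℝ × Matrix (Fin m) (Fin n) ℝ) :=
    {x | x.1ᵀ * x.1 = 1 ∧ x.1 * leadProj m r * x.1ᵀ * x.2 = x.2 ∧ ‖M - x.2‖ ≤ ‖M - T₀‖}
  have hmem {T : Matrix (Fin m) (Fin n) ℝ} (hT : IsBestRankApprox M r T) : ∃ U, (U, T) ∈ K := by
    obtain ⟨W, hW, hWT⟩ := exists_lead_projection hT.1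
    exact ⟨W, transpose_mul_self_of_mem hW, hWT, (hT.norm_sub_eq hT₀).le⟩
  have hclosed : IsClosed K := by
    have h1 : IsClosed {x : Matrix (Fin m) (Fin m) ℝ × Matrix (Fin m) (Fin n) ℝ |
        x.1ᵀ * x.1 = 1} := isClosed_eq (by fun_prop) (by fun_prop)
    have h2 : IsClosed {x : Matrix (Fin m) (Fin m) ℝ × Matrix (Fin m) (Fin n) ℝ |
        x.1 * leadProj m r * x.1ᵀ * x.2 = x.2} := isClosed_eq (by fun_prop) (by fun_prop)
    have h3 : IsClosed {x : Matrix (Fin m) (Fin m) ℝ × Matrix (Fin m) (Fin n) ℝ |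
        ‖M - x.2‖ ≤ ‖M - T₀‖} := isClosed_le (by fun_prop) (by fun_prop)
    exact h1.inter (h2.inter h3)
  have hbdd : Bornology.IsBounded K := by
    rw [isBounded_iff_forall_norm_le]
    refine ⟨max (m + 1) (‖M‖ + ‖M - T₀‖), fun x hx => ?_⟩
    rw [Prod.norm_def]
    refine max_le_max ?_ ?_
    · have h1 := frobenius_sq_eq_trace x.1
      rw [hx.1, trace_one, Fintype.card_fin] at h1
      nlinarith [norm_nonneg x.1, Nat.cast_nonneg (α := ℝ) m]
    · have h1 := norm_sub_norm_le x.2 M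
      have h2 := hx.2.2
      rw [norm_sub_rev] at h1
      linarith
  have : ProperSpace (Matrix (Fin m) (Fin m) ℝ) := FiniteDimensional.proper ℝ _
  have : ProperSpace (Matrix (Fin m) (Fin n) ℝ) := FiniteDimensional.proper ℝ _
  have hK : IsCompact K := Metric.isCompact_of_isClosed_isBounded hclosed hbdd
  obtain ⟨W₀, hW₀⟩ := hmem hT₀
  obtain ⟨⟨U, T⟩, hUT, hmin⟩ := hK.exists_isMinOn ⟨_, hW₀⟩ (hφ.comp continuous_snd).continuousOn
  refine ⟨T, ⟨?_, fun T' hT' => hUT.2.2.trans (hT₀.2 T' hT')⟩, fun T' hT' => ?_⟩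
  · have h1 : U * leadProj m r * Uᵀ * T = T := hUT.2.1
    have h2 : (leadProj m r).rank ≤ r := by
      have : leadProj m r = rectDiag m m (fun k => if k < r then 1 else 0) := by
        rw [rectDiag_self]
        rfl
      rw [this]
      exact rank_rectDiag_le _ fun k hk => if_neg (not_lt.2 hk)
    rw [← h1]
    exact (rank_mul_le_left _ _).trans
      ((rank_mul_le_left _ _).trans ((rank_mul_le_right _ _).trans h2))
  · obtain ⟨W, hW⟩ := hmem hT'
    exact hmin hW

end Compactness

/-! ### Reduction to the compressed problem. -/

section Reduction

variable {ι κ : Type*} [Fintype ι] [Fintype κ] {s t r : ℕ}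

/-- Compressing by isometries does not increase the norm, and keeps it only for matrices supported
on their ranges. -/
theorem frobenius_sq_compress {P : Matrix ι (Fin s) ℝ} {Q : Matrix κ (Fin t) ℝ} (hP : Pᵀ * P = 1)
    (hQ : Qᵀ * Q = 1) (X : Matrix ι κ ℝ) :
    ‖X‖ ^ 2 = ‖X - P * (Pᵀ * X * Q) * Qᵀ‖ ^ 2 + ‖P * (Pᵀ * X * Q) * Qᵀ‖ ^ 2 := by
  rw [frobenius_sq_sub_isometry hP hQ, frobenius_sq_isometry hP hQ, sub_self, norm_zero]
  ring

theorem isometry_compress {P : Matrix ι (Fin s) ℝ} {Q : Matrix κ (Fin t) ℝ} (hP : Pᵀ * P = 1)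
    (hQ : Qᵀ * Q = 1) (Y : Matrix (Fin s) (Fin t) ℝ) : Pᵀ * (P * Y * Qᵀ) * Q = Y := by
  have : Pᵀ * (P * Y * Qᵀ) * Q = (Pᵀ * P) * Y * (Qᵀ * Q) := by
    simp only [Matrix.mul_assoc]
  rw [this, hP, hQ, Matrix.one_mul, Matrix.mul_one]

variable {m n p q : ℕ}

/-- A compact factorization `B = P S Qᵀ`: `P`, `Q` have orthonormal columns, `S` is invertible. -/
structure IsCompactFactorization (B : Matrix (Fin m) (Fin p) ℝ) (P : Matrix (Fin m) (Fin s) ℝ)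
    (S : Matrix (Fin s) (Fin s) ℝ) (Q : Matrix (Fin p) (Fin s) ℝ) : Prop where
  left : Pᵀ * P = 1
  right : Qᵀ * Q = 1
  isUnit : IsUnit S.det
  factorization : B = P * S * Qᵀ

variable {A : Matrix (Fin m) (Fin n) ℝ} {B : Matrix (Fin m) (Fin p) ℝ}
  {C : Matrix (Fin q) (Fin n) ℝ} {P₁ : Matrix (Fin m) (Fin s) ℝ} {S : Matrix (Fin s) (Fin s) ℝ}
  {Q₁ : Matrix (Fin p) (Fin s) ℝ} {P₂ : Matrix (Fin q) (Fin t) ℝ} {R : Matrix (Fin t) (Fin t) ℝ}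
  {Q₂ : Matrix (Fin n) (Fin t) ℝ}

theorem IsCompactFactorization.mul_mul (hB : IsCompactFactorization B P₁ S Q₁)
    (hC : IsCompactFactorization C P₂ R Q₂) (X : Matrix (Fin p) (Fin q) ℝ) :
    B * X * C = P₁ * (S * (Q₁ᵀ * X * P₂) * R) * Q₂ᵀ := by
  rw [hB.factorization, hC.factorization]
  simp only [Matrix.mul_assoc]

theorem inv_mul_mul_inv (hS : IsUnit S.det) (hR : IsUnit R.det) (Y : Matrix (Fin s) (Fin t) ℝ) :
    S⁻¹ * (S * Y * R) * R⁻¹ = Y := by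
  have : S⁻¹ * (S * Y * R) * R⁻¹ = (S⁻¹ * S) * Y * (R * R⁻¹) := by
    simp only [Matrix.mul_assoc]
  rw [this, nonsing_inv_mul S hS, mul_nonsing_inv R hR, Matrix.one_mul, Matrix.mul_one]

theorem mul_inv_mul_inv_mul (hS : IsUnit S.det) (hR : IsUnit R.det)
    (Y : Matrix (Fin s) (Fin t) ℝ) : S * (S⁻¹ * Y * R⁻¹) * R = Y := by
  have : S * (S⁻¹ * Y * R⁻¹) * R = (S * S⁻¹) * Y * (R⁻¹ * R) := by
    simp only [Matrix.mul_assoc]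
  rw [this, nonsing_inv_mul R hR, mul_nonsing_inv S hS, Matrix.one_mul, Matrix.mul_one]

theorem rank_mul_mul_le {a b c d : ℕ} (X : Matrix (Fin a) (Fin b) ℝ) (Y : Matrix (Fin b) (Fin c) ℝ)
    (Z : Matrix (Fin c) (Fin d) ℝ) : (X * Y * Z).rank ≤ Y.rank :=
  (rank_mul_le_left _ _).trans (rank_mul_le_right _ _)

theorem IsCompactFactorization.frobenius_sq_sub (hB : IsCompactFactorization B P₁ S Q₁)
    (hC : IsCompactFactorization C P₂ R Q₂) (X : Matrix (Fin p) (Fin q) ℝ) :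
    ‖A - B * X * C‖ ^ 2 = ‖P₁ᵀ * A * Q₂ - S * (Q₁ᵀ * X * P₂) * R‖ ^ 2 +
      (‖A‖ ^ 2 - ‖P₁ᵀ * A * Q₂‖ ^ 2) := by
  rw [hB.mul_mul hC, frobenius_sq_sub_isometry hB.left hC.right]

theorem IsCompactFactorization.compress_lift (hB : IsCompactFactorization B P₁ S Q₁)
    (hC : IsCompactFactorization C P₂ R Q₂) (T : Matrix (Fin s) (Fin t) ℝ) :
    S * (Q₁ᵀ * (Q₁ * (S⁻¹ * T * R⁻¹) * P₂ᵀ) * P₂) * R = T := by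
  rw [isometry_compress hB.right hC.left, mul_inv_mul_inv_mul hB.isUnit hC.isUnit]

/-- Compression and lift do not raise the rank, and every `T` is the compression of its lift; hence
both minimizations have the same competitors. -/
theorem IsCompactFactorization.isSolution_iff (hB : IsCompactFactorization B P₁ S Q₁)
    (hC : IsCompactFactorization C P₂ R Q₂) (X : Matrix (Fin p) (Fin q) ℝ) :
    IsSolution A B C r X ↔
      X.rank ≤ r ∧ IsBestRankApprox (P₁ᵀ * A * Q₂) r (S * (Q₁ᵀ * X * P₂) * R) := by
  constructor
  · rintro ⟨hX, hopt⟩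
    refine ⟨hX, (rank_mul_mul_le _ _ _).trans ((rank_mul_mul_le _ _ _).trans hX), fun T hT => ?_⟩
    have h := hopt (Q₁ * (S⁻¹ * T * R⁻¹) * P₂ᵀ)
      ((rank_mul_mul_le _ _ _).trans ((rank_mul_mul_le _ _ _).trans hT))
    have h2 := pow_le_pow_left₀ (norm_nonneg _) h 2
    rw [hB.frobenius_sq_sub hC, hB.frobenius_sq_sub hC, hB.compress_lift hC] at h2
    exact le_of_sq_le_sq (by linarith) (norm_nonneg _)
  · rintro ⟨hX, -, hopt⟩
    refine ⟨hX, fun Y hY => ?_⟩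
    have h := hopt (S * (Q₁ᵀ * Y * P₂) * R)
      ((rank_mul_mul_le _ _ _).trans ((rank_mul_mul_le _ _ _).trans hY))
    have h2 := pow_le_pow_left₀ (norm_nonneg _) h 2
    refine le_of_sq_le_sq ?_ (norm_nonneg _)
    rw [hB.frobenius_sq_sub hC, hB.frobenius_sq_sub hC]
    linarith

theorem IsCompactFactorization.isSolution_lift (hB : IsCompactFactorization B P₁ S Q₁)
    (hC : IsCompactFactorization C P₂ R Q₂) {T : Matrix (Fin s) (Fin t) ℝ}
    (hT : IsBestRankApprox (P₁ᵀ * A * Q₂) r T) :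
    IsSolution A B C r (Q₁ * (S⁻¹ * T * R⁻¹) * P₂ᵀ) := by
  rw [hB.isSolution_iff hC, hB.compress_lift hC]
  exact ⟨(rank_mul_mul_le _ _ _).trans ((rank_mul_mul_le _ _ _).trans hT.1), hT⟩

/-- Among all `Y` with a given compression `T`, the lift of `T` has the strictly smallest norm. -/
theorem IsCompactFactorization.norm_lift_lt (hB : IsCompactFactorization B P₁ S Q₁)
    (hC : IsCompactFactorization C P₂ R Q₂) {Y : Matrix (Fin p) (Fin q) ℝ}
    (hY : Y ≠ Q₁ * (S⁻¹ * (S * (Q₁ᵀ * Y * P₂) * R) * R⁻¹) * P₂ᵀ) :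
    ‖Q₁ * (S⁻¹ * (S * (Q₁ᵀ * Y * P₂) * R) * R⁻¹) * P₂ᵀ‖ < ‖Y‖ := by
  rw [inv_mul_mul_inv hB.isUnit hC.isUnit] at hY ⊢
  have h := frobenius_sq_compress hB.right hC.left Y
  have : 0 < ‖Y - Q₁ * (Q₁ᵀ * Y * P₂) * P₂ᵀ‖ ^ 2 :=
    pow_pos (norm_pos_iff.2 (sub_ne_zero.2 hY)) 2
  exact lt_of_pow_lt_pow_left₀ 2 (norm_nonneg _) (by linarith)

theorem IsCompactFactorization.compress_eq_of_mul_eq (hB : IsCompactFactorization B P₁ S Q₁)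
    (hC : IsCompactFactorization C P₂ R Q₂) {X Y : Matrix (Fin p) (Fin q) ℝ}
    (h : B * Y * C = B * X * C) : S * (Q₁ᵀ * Y * P₂) * R = S * (Q₁ᵀ * X * P₂) * R := by
  rw [hB.mul_mul hC, hB.mul_mul hC] at h
  rw [← isometry_compress hB.left hC.right (S * (Q₁ᵀ * Y * P₂) * R), h,
    isometry_compress hB.left hC.right]

theorem IsCompactFactorization.norm_lt_of_mul_eq (hB : IsCompactFactorization B P₁ S Q₁)
    (hC : IsCompactFactorization C P₂ R Q₂) {T : Matrix (Fin s) (Fin t) ℝ}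
    {Y : Matrix (Fin p) (Fin q) ℝ}
    (hYT : S * (Q₁ᵀ * Y * P₂) * R = T) (hne : Y ≠ Q₁ * (S⁻¹ * T * R⁻¹) * P₂ᵀ) :
    ‖Q₁ * (S⁻¹ * T * R⁻¹) * P₂ᵀ‖ < ‖Y‖ := by
  subst hYT
  exact hB.norm_lift_lt hC hne

theorem IsCompactFactorization.norm_lift_le (hB : IsCompactFactorization B P₁ S Q₁)
    (hC : IsCompactFactorization C P₂ R Q₂) (Y : Matrix (Fin p) (Fin q) ℝ) :
    ‖Q₁ * (S⁻¹ * (S * (Q₁ᵀ * Y * P₂) * R) * R⁻¹) * P₂ᵀ‖ ≤ ‖Y‖ := by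
  by_cases hY : Y = Q₁ * (S⁻¹ * (S * (Q₁ᵀ * Y * P₂) * R) * R⁻¹) * P₂ᵀ
  · exact (congrArg norm hY).ge
  · exact (hB.norm_lift_lt hC hY).le

theorem IsCompactFactorization.isMinNormSolution_lift (hB : IsCompactFactorization B P₁ S Q₁)
    (hC : IsCompactFactorization C P₂ R Q₂) {T : Matrix (Fin s) (Fin t) ℝ}
    (hT : IsBestRankApprox (P₁ᵀ * A * Q₂) r T)
    (hmin : ∀ T', IsBestRankApprox (P₁ᵀ * A * Q₂) r T' →
      ‖Q₁ * (S⁻¹ * T * R⁻¹) * P₂ᵀ‖ ≤ ‖Q₁ * (S⁻¹ * T' * R⁻¹) * P₂ᵀ‖) :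
    IsMinNormSolution A B C r (Q₁ * (S⁻¹ * T * R⁻¹) * P₂ᵀ) :=
  ⟨hB.isSolution_lift hC hT, fun Y hY =>
    (hmin _ ((hB.isSolution_iff hC Y).1 hY).2).trans (hB.norm_lift_le hC Y)⟩

end Reduction

/-! ### Leading blocks in terms of coordinate inclusions. -/

section Blocks

variable {m n p q s t : ℕ}

/-- The inclusion of the first `s` coordinates. -/
def incl (m s : ℕ) : Matrix (Fin m) (Fin s) ℝ := rectDiag m s fun _ => 1

theorem incl_transpose_mul_self (h : s ≤ m) : (incl m s)ᵀ * incl m s = 1 := by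
  rw [incl, rectDiag_transpose, rectDiag_mul_rectDiag _ _ (fun l hl hm => by omega), rectDiag_self]
  simp

theorem mul_incl_apply {ι : Type*} (W : Matrix ι (Fin n) ℝ) (h : s ≤ n) (i : ι) (j : Fin s) :
    (W * incl n s) i j = W i (Fin.castLE h j) := by
  rw [mul_apply, Finset.sum_eq_single (Fin.castLE h j)]
  · simp [incl, rectDiag_apply]
  · intro b _ hb
    rw [incl, rectDiag_apply, if_neg, mul_zero]
    exact fun h' => hb (Fin.ext h')
  · simp

theorem submatrix_castLE (W : Matrix (Fin m) (Fin n) ℝ) (hs : s ≤ m) (ht : t ≤ n) :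
    W.submatrix (Fin.castLE hs) (Fin.castLE ht) = (incl m s)ᵀ * W * incl n t := by
  ext i j
  rw [mul_incl_apply _ ht, submatrix_apply, ← transpose_apply ((incl m s)ᵀ * W), transpose_mul,
    transpose_transpose, mul_incl_apply _ hs, transpose_apply]

theorem padZero_eq (Y : Matrix (Fin s) (Fin t) ℝ) :
    padZero p q Y = incl p s * Y * (incl q t)ᵀ := by
  have hrow (i : Fin p) (k : Fin t) :
      (incl p s * Y) i k = if h : (i : ℕ) < s then Y ⟨i, h⟩ k else 0 := by
    rw [mul_apply]
    split_ifs with h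
    · rw [Finset.sum_eq_single ⟨i, h⟩]
      · simp [incl, rectDiag_apply]
      · intro b _ hb
        rw [incl, rectDiag_apply, if_neg, zero_mul]
        exact fun h' => hb (Fin.ext h'.symm)
      · simp
    · refine Finset.sum_eq_zero fun b _ => ?_
      rw [incl, rectDiag_apply, if_neg (by omega), zero_mul]
  ext i j
  rw [mul_apply]
  simp only [hrow, padZero, of_apply]
  by_cases hj : (j : ℕ) < t
  · rw [Finset.sum_eq_single ⟨j, hj⟩]
    · simp [incl, rectDiag_apply, hj]
    · intro b _ hb
      rw [transpose_apply, incl, rectDiag_apply, if_neg, mul_zero]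
      exact fun h' => hb (Fin.ext h'.symm)
    · simp
  · rw [dif_neg (by omega), Finset.sum_eq_zero]
    intro b _
    rw [transpose_apply, incl, rectDiag_apply, if_neg (by omega), mul_zero]

theorem isometry_mul_incl {U : Matrix (Fin m) (Fin m) ℝ} (hU : U ∈ orthogonalGroup (Fin m) ℝ)
    (h : s ≤ m) : (U * incl m s)ᵀ * (U * incl m s) = 1 := by
  have : (U * incl m s)ᵀ * (U * incl m s) = (incl m s)ᵀ * (Uᵀ * U) * incl m s := by
    simp only [transpose_mul, Matrix.mul_assoc]
  rw [this, transpose_mul_self_of_mem hU, Matrix.mul_one, incl_transpose_mul_self h]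

theorem IsSVD.isCompactFactorization {B : Matrix (Fin m) (Fin p) ℝ} {U σ V} (h : IsSVD B U σ V) :
    IsCompactFactorization B (U * incl m B.rank) (diagonal fun i : Fin B.rank => σ i)
      (V * incl p B.rank) where
  left := isometry_mul_incl h.left_orthogonal B.rank_le_height
  right := isometry_mul_incl h.right_orthogonal B.rank_le_width
  isUnit := by
    rw [det_diagonal, isUnit_iff_ne_zero, Finset.prod_ne_zero_iff]
    exact fun i _ => ((h.lt_rank_iff i).1 i.2).ne'
  factorization := by
    have hσ (k : ℕ) (hk : B.rank ≤ k) : σ k = 0 :=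
      le_antisymm (not_lt.1 ((h.lt_rank_iff k).not.1 (not_lt.2 hk))) (h.nonneg k)
    have h1 : rectDiag m p σ =
        incl m B.rank * (diagonal fun i : Fin B.rank => σ i) * (incl p B.rank)ᵀ := by
      rw [← rectDiag_self, incl, incl, rectDiag_transpose, rectDiag_mul_rectDiag,
        rectDiag_mul_rectDiag]
      · simp
      · intro l _ hl
        simp [hσ l hl]
      · intro l _ hl
        simp [hσ l hl]
    conv_lhs => rw [h.factorization, h1]
    simp only [transpose_mul, Matrix.mul_assoc]

theorem block11_eq (A : Matrix (Fin m) (Fin n) ℝ) (B : Matrix (Fin m) (Fin p) ℝ)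
    (C : Matrix (Fin q) (Fin n) ℝ) (UB : Matrix (Fin m) (Fin m) ℝ) (VC : Matrix (Fin n) (Fin n) ℝ) :
    block11 A B C UB VC = (UB * incl m B.rank)ᵀ * A * (VC * incl n C.rank) := by
  rw [block11, submatrix_castLE]
  simp only [transpose_mul, Matrix.mul_assoc]

theorem liftSolution_eq (VB : Matrix (Fin p) (Fin p) ℝ) (σB : ℕ → ℝ)
    (UC : Matrix (Fin q) (Fin q) ℝ) (σC : ℕ → ℝ)
    (T : Matrix (Fin s) (Fin t) ℝ) :
    liftSolution VB σB UC σC T = VB * incl p s *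
      ((diagonal fun i : Fin s => σB i)⁻¹ * T * (diagonal fun j : Fin t => σC j)⁻¹) *
      (UC * incl q t)ᵀ := by
  rw [liftSolution, padZero_eq]
  simp only [transpose_mul, Matrix.mul_assoc]

end Blocks

end RankApprox

theorem mainTheorem3 {m n p q : ℕ} (A : Matrix (Fin m) (Fin n) ℝ)
    (B : Matrix (Fin m) (Fin p) ℝ) (C : Matrix (Fin q) (Fin n) ℝ) (r : ℕ) :
    (∃ UB σB VB, RankApprox.IsSVD B UB σB VB) ∧
    (∃ UC σC VC, RankApprox.IsSVD C UC σC VC) ∧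
    ∀ (UB : Matrix (Fin m) (Fin m) ℝ) (σB : ℕ → ℝ) (VB : Matrix (Fin p) (Fin p) ℝ)
      (UC : Matrix (Fin q) (Fin q) ℝ) (σC : ℕ → ℝ) (VC : Matrix (Fin n) (Fin n) ℝ),
      RankApprox.IsSVD B UB σB VB → RankApprox.IsSVD C UC σC VC →
      -- the diagonal matrices `S_B`, `S_C` are invertible
      (∀ i : Fin B.rank, 0 < σB i) ∧ (∀ j : Fin C.rank, 0 < σC j) ∧
      -- every choice of the decomposition of `A₁₁` gives a global solution
      (∀ (U : Matrix (Fin B.rank) (Fin B.rank) ℝ) (σ : ℕ → ℝ)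
        (V : Matrix (Fin C.rank) (Fin C.rank) ℝ),
        RankApprox.IsSVD (RankApprox.block11 A B C UB VC) U σ V →
        ∀ X : Matrix (Fin p) (Fin q) ℝ,
          X = RankApprox.liftSolution VB σB UC σC (RankApprox.truncation U σ V r) →
          RankApprox.IsBestRankApprox (RankApprox.block11 A B C UB VC) r
            (RankApprox.truncation U σ V r) ∧
          RankApprox.IsSolution A B C r X ∧
          -- it is the minimum-norm one among all matrices with the same product
          (∀ Y : Matrix (Fin p) (Fin q) ℝ, B * Y * C = B * X * C → Y ≠ X → ‖X‖ < ‖Y‖) ∧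
          -- it is the minimum-norm solution when the best rank-`r` approximation is unique
          ((r = 0 ∨ σ r < σ (r - 1) ∨ σ r = 0) →
            RankApprox.IsMinNormSolution A B C r X ∧
            ∀ Y : Matrix (Fin p) (Fin q) ℝ,
              RankApprox.IsMinNormSolution A B C r Y → Y = X)) ∧
      -- some choice of the decomposition of `A₁₁` gives a minimum-norm solution
      (∃ (U : Matrix (Fin B.rank) (Fin B.rank) ℝ) (σ : ℕ → ℝ)
        (V : Matrix (Fin C.rank) (Fin C.rank) ℝ),
        RankApprox.IsSVD (RankApprox.block11 A B C UB VC) U σ V ∧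
        RankApprox.IsMinNormSolution A B C r
          (RankApprox.liftSolution VB σB UC σC (RankApprox.truncation U σ V r))) := by
  refine ⟨RankApprox.exists_isSVD B, RankApprox.exists_isSVD C, ?_⟩
  intro UB σB VB UC σC VC hB hC
  have hB' := hB.isCompactFactorization
  have hC' := hC.isCompactFactorization
  have hlift := RankApprox.liftSolution_eq (s := B.rank) (t := C.rank) VB σB UC σC
  refine ⟨fun i => (hB.lt_rank_iff i).1 i.2, fun j => (hC.lt_rank_iff j).1 j.2, ?_, ?_⟩
  · intro U σ V h X hX
    have hT := RankApprox.isBestRankApprox_truncation h r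
    rw [hlift] at hX
    subst hX
    refine ⟨hT, ?_⟩
    rw [RankApprox.block11_eq] at h hT
    refine ⟨hB'.isSolution_lift hC' hT, fun Y hY hne => ?_, fun hgap => ?_⟩
    · refine hB'.norm_lt_of_mul_eq hC' ?_ hne
      rw [hB'.compress_eq_of_mul_eq hC' hY, hB'.compress_lift hC']
    · have hmin := hB'.isMinNormSolution_lift hC' hT
        fun T' hT' => by rw [hT'.eq_truncation h hgap]
      refine ⟨hmin, fun Y hY => ?_⟩
      by_contra hne
      -- By uniqueness of the best approximation, `Y` has the same compression as the lift, hence is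
      -- strictly longer unless equal to it.
      refine (hB'.norm_lt_of_mul_eq hC' ?_ hne).not_ge (hY.2 _ hmin.1)
      exact ((hB'.isSolution_iff hC' Y).1 hY.1).2.eq_truncation h hgap
  -- Best approximations share one norm, but their lifts need not, because of the factors `S_B⁻¹`
  -- and `S_C⁻¹`; so the norm of the lift is minimized.
  · obtain ⟨T, hT, hmin⟩ := RankApprox.exists_isBestRankApprox_minimizing
      (RankApprox.block11 A B C UB VC) r
      (φ := fun T => ‖RankApprox.liftSolution VB σB UC σC T‖) (by
        simp only [hlift]
        fun_prop)
    obtain ⟨U, σ, V, h, rfl⟩ := hT.exists_isSVD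
    refine ⟨U, σ, V, h, ?_⟩
    rw [hlift]
    rw [RankApprox.block11_eq] at hT hmin
    exact hB'.isMinNormSolution_lift hC' hT fun T' hT' => by simpa only [hlift] using hmin T' hT'
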